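/- Let $I=[0,1]$ and let $\mathbb{K}^2$ be the Klein bottle, that is, the quotient space of the square $I\times I$ by the equivalence relation generated by $(0,t)\sim(1,t)$ and $(s,0)\sim(1-s,1)$ for $s,t\in I$. Let $x_0\in\mathbb{K}^2$ be the common image of the four corners, and let $\alpha,\beta$ be the loops at $x_0$ given by $\alpha(t)=[(0,t)]$ and $\beta(s)=[(s,0)]$; the boundary of the square, traversed counterclockwise from $(0,0)$, then reads $\beta\alpha\beta\alpha^{-1}$. Then the loop $\beta\alpha\beta\alpha^{-1}$ is homotopic, relative to its endpoints, to the constant loop $\rho_{x_0}$, and the fundamental group $\pi_1(\mathbb{K}^2,x_0)$ is generated by the classes of $\alpha$ and $\beta$ with this as the single defining relation: there is a group isomorphism $$\langle \alpha,\beta \mid \beta\alpha\beta\alpha^{-1}\rangle \;\cong\; \pi_1(\mathbb{K}^2,x_0)$$ that maps the generators $\alpha$ and $\beta$ to the homotopy classes of the loops $\alpha$ and $\beta$. For every other base point $x\in\mathbb{K}^2$ the group $\pi_1(\mathbb{K}^2,x)$ is also isomorphic to $\langle \alpha,\beta \mid \beta\alpha\beta\alpha^{-1}\rangle$. -/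

import Mathlib

open scoped unitInterval

/-- The identifications of the unit square `I × I` that produce the Klein bottle: the left and the
right side are glued with the same orientation, the bottom and the top side with opposite
orientations. -/
inductive KleinGlue : I × I → I × I → Prop
  | sides (t : I) : KleinGlue (0, t) (1, t)
  | flip (s : I) : KleinGlue (s, 0) (unitInterval.symm s, 1)

/-- The Klein bottle: the quotient of the unit square by the equivalence relation generated by
`KleinGlue`. -/
def KleinBottle : Type := Quot KleinGlue

namespace KleinBottle

/-- The quotient topology. -/
instance : TopologicalSpace KleinBottle := inferInstanceAs (TopologicalSpace (Quot KleinGlue))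

/-- The projection of the square onto the Klein bottle. -/
def proj (p : I × I) : KleinBottle := Quot.mk KleinGlue p

theorem continuous_proj : Continuous proj := continuous_quot_mk

/-- The base point: the common image of the four corners of the square. -/
def basePoint : KleinBottle := proj (0, 0)

theorem proj_one_zero : proj (1, 0) = basePoint := (Quot.sound (KleinGlue.sides 0)).symm

theorem proj_one_one : proj (1, 1) = basePoint := by
  have h := Quot.sound (KleinGlue.flip 0)
  rw [unitInterval.symm_zero] at h
  exact h.symm

theorem proj_zero_one : proj (0, 1) = basePoint :=
  (Quot.sound (KleinGlue.sides 1)).trans proj_one_one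

/-- The loop `α`: the image of the left side (equivalently, of the right side) of the square,
traversed upwards. -/
def loopAlpha : Path basePoint basePoint where
  toFun t := proj (0, t)
  continuous_toFun := continuous_proj.comp (by fun_prop)
  source' := rfl
  target' := proj_zero_one

/-- The loop `β`: the image of the bottom side of the square traversed from left to right
(equivalently, of the top side traversed from right to left). Thus the boundary of the square,
traversed counterclockwise from the corner `(0, 0)`, reads `β α β α⁻¹`. -/
def loopBeta : Path basePoint basePoint where
  toFun s := proj (s, 0)
  continuous_toFun := continuous_proj.comp (by fun_prop)
  source' := rfl
  target' := proj_one_zero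

/-- The class of a loop at the base point in the fundamental group. -/
def loopClass (γ : Path basePoint basePoint) : FundamentalGroup KleinBottle basePoint :=
  FundamentalGroup.fromPath (Path.Homotopic.Quotient.mk γ)

end KleinBottle

/-- The two generator symbols of the presentation. -/
inductive KleinGen
  | α
  | β

/-- The word `β α β α⁻¹` in the free group on the two generator symbols. -/
def kleinRelator : FreeGroup KleinGen :=
  FreeGroup.of KleinGen.β * FreeGroup.of KleinGen.α * FreeGroup.of KleinGen.β *
    (FreeGroup.of KleinGen.α)⁻¹

/-- The group `⟨α, β | β α β α⁻¹⟩`. -/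
abbrev KleinGroup : Type := PresentedGroup ({kleinRelator} : Set (FreeGroup KleinGen))

namespace KleinGroup

/-! The presented group itself acts on the plane, `α` as a glide reflection and `β` as a
translation. The relation moves every `α` to the right of every `β` (`exists_eq_zpow_mul_zpow`), so
each element acts by an explicit formula in two integers. This shows that the action is free and
properly discontinuous. Freeness is what excludes further relations. The unit square maps
bijectively from its quotient `KleinBottle` onto the orbit space, so the simply connected plane
covers the Klein bottle with this group as deck group. Lifting the two loops from the origin
identifies the generators; reversal of words corrects for the opposite group that monodromy
produces. -/

/-- The generator `α` of the presented group. -/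
def genA : KleinGroup := PresentedGroup.of KleinGen.α

/-- The generator `β` of the presented group. -/
def genB : KleinGroup := PresentedGroup.of KleinGen.β

theorem relation : genB * genA * genB * genA⁻¹ = 1 :=
  PresentedGroup.one_of_mem (Set.mem_singleton kleinRelator)

theorem conj_genB : genA * genB * genA⁻¹ = genB⁻¹ := by
  rw [eq_inv_iff_mul_eq_one, mul_eq_one_iff_eq_inv, eq_comm, inv_eq_iff_mul_eq_one]
  simpa only [mul_assoc] using relation

theorem genA_mul_zpow (m : ℤ) : genA * genB ^ m = genB ^ (-m) * genA := by
  rw [← mul_inv_eq_iff_eq_mul, ← conj_zpow, conj_genB, inv_zpow']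

theorem genA_inv_mul_zpow (m : ℤ) : genA⁻¹ * genB ^ m = genB ^ (-m) * genA⁻¹ := by
  rw [inv_mul_eq_iff_eq_mul, ← mul_assoc, genA_mul_zpow, neg_neg, mul_inv_cancel_right]

/-- Every element has the normal form `β ^ m * α ^ n`. -/
theorem exists_eq_zpow_mul_zpow (g : KleinGroup) : ∃ m n : ℤ, g = genB ^ m * genA ^ n := by
  have hg : g ∈ Subgroup.closure (Set.range (PresentedGroup.of (rels := {kleinRelator}))) := by
    rw [PresentedGroup.closure_range_of]; trivial
  induction hg using Subgroup.closure_induction_left with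
  | one => exact ⟨0, 0, by simp⟩
  | mul_left x hx y _ ih =>
    obtain ⟨m, n, rfl⟩ := ih
    obtain ⟨_ | _, rfl⟩ := hx
    · refine ⟨-m, n + 1, ?_⟩
      change genA * _ = _
      rw [← mul_assoc, genA_mul_zpow, mul_assoc, add_comm n, zpow_add, zpow_one]
    · refine ⟨m + 1, n, ?_⟩
      change genB * _ = _
      rw [← mul_assoc, add_comm m, zpow_add, zpow_one]
  | inv_mul_cancel x hx y _ ih =>
    obtain ⟨m, n, rfl⟩ := ih
    obtain ⟨_ | _, rfl⟩ := hx
    · refine ⟨-m, n - 1, ?_⟩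
      change genA⁻¹ * _ = _
      rw [← mul_assoc, genA_inv_mul_zpow, mul_assoc, sub_eq_neg_add, zpow_add, zpow_neg_one]
    · refine ⟨m - 1, n, ?_⟩
      change genB⁻¹ * _ = _
      rw [← mul_assoc, sub_eq_neg_add, zpow_add, zpow_neg_one]

/-- Reversing words is a homomorphism to the opposite group fixing the generators. -/
def reverse : KleinGroup →* KleinGroupᵐᵒᵖ :=
  PresentedGroup.toGroup (f := fun x ↦ MulOpposite.op (PresentedGroup.of x)) (by
    rintro r rfl
    apply MulOpposite.unop_injective
    -- The reversed relator is a cyclic permutation of the relator, hence trivial too.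
    change genA⁻¹ * (genB * (genA * genB)) = 1
    rw [inv_mul_eq_one, ← mul_assoc]
    exact (mul_inv_eq_one.mp relation).symm)

@[simp]
theorem reverse_of (x : KleinGen) :
    reverse (PresentedGroup.of x) = MulOpposite.op (PresentedGroup.of x) :=
  PresentedGroup.toGroup.of _

theorem unop_reverse_unop_reverse (g : KleinGroup) : (reverse (reverse g).unop).unop = g := by
  have h : (MulEquiv.opOp KleinGroup).symm.toMonoidHom.comp
      ((MonoidHom.op reverse).comp reverse) = MonoidHom.id KleinGroup := by
    apply PresentedGroup.ext
    intro x
    simp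
  exact DFunLike.congr_fun h g

/-- The presented group is isomorphic to its opposite by reversal of words. -/
def reverseEquiv : KleinGroup ≃* KleinGroupᵐᵒᵖ where
  __ := reverse
  invFun x := (reverse x.unop).unop
  left_inv := unop_reverse_unop_reverse
  right_inv x := MulOpposite.unop_injective (unop_reverse_unop_reverse x.unop)

/-! ### The free, properly discontinuous action on the plane -/

/-- The glide reflection `(x, y) ↦ (-x, y + 1)` of the plane. -/
def glide : Equiv.Perm (ℝ × ℝ) where
  toFun p := (-p.1, p.2 + 1)
  invFun p := (-p.1, p.2 - 1)
  left_inv p := by simp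
  right_inv p := by simp

/-- The translation `(x, y) ↦ (x + 1, y)` of the plane. -/
def shift : Equiv.Perm (ℝ × ℝ) where
  toFun p := (p.1 + 1, p.2)
  invFun p := (p.1 - 1, p.2)
  left_inv p := by simp
  right_inv p := by simp

theorem glide_zpow_apply (n : ℤ) (p : ℝ × ℝ) :
    (glide ^ n) p = ((-1) ^ n * p.1, p.2 + n) := by
  induction n generalizing p with
  | zero => simp
  | succ k ih =>
    rw [zpow_add_one, Equiv.Perm.mul_apply, ih, zpow_add_one₀ (by norm_num)]
    ext <;> simp [glide]; ring
  | pred k ih =>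
    rw [zpow_sub_one, Equiv.Perm.mul_apply, ih, zpow_sub_one₀ (by norm_num)]
    ext <;> simp [glide, Equiv.Perm.inv_def, Equiv.symm]; ring

theorem shift_zpow_apply (m : ℤ) (p : ℝ × ℝ) : (shift ^ m) p = (p.1 + m, p.2) := by
  induction m generalizing p with
  | zero => simp
  | succ k ih =>
    rw [zpow_add_one, Equiv.Perm.mul_apply, ih]
    ext <;> simp [shift]; ring
  | pred k ih =>
    rw [zpow_sub_one, Equiv.Perm.mul_apply, ih]
    ext <;> simp [shift, Equiv.Perm.inv_def, Equiv.symm]; ring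

/-- The homomorphism sending `α` to the glide reflection and `β` to the translation. -/
def toPerm : KleinGroup →* Equiv.Perm (ℝ × ℝ) :=
  PresentedGroup.toGroup
    (f := fun x ↦ match x with
      | KleinGen.α => glide
      | KleinGen.β => shift) (by
    rintro r rfl
    simp only [kleinRelator, map_mul, map_inv, FreeGroup.lift_apply_of]
    ext p <;> simp [glide, shift, Equiv.Perm.inv_def, Equiv.symm])

/-- The action on the plane by glide reflections and translations. -/
instance : MulAction KleinGroup (ℝ × ℝ) := MulAction.compHom _ toPerm

theorem zpow_mul_zpow_smul (m n : ℤ) (p : ℝ × ℝ) :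
    (genB ^ m * genA ^ n) • p = ((-1) ^ n * p.1 + m, p.2 + n) := by
  change toPerm (genB ^ m * genA ^ n) p = _
  have hA : toPerm genA = glide := PresentedGroup.toGroup.of _
  have hB : toPerm genB = shift := PresentedGroup.toGroup.of _
  rw [map_mul, map_zpow, map_zpow, hA, hB, Equiv.Perm.mul_apply, glide_zpow_apply,
    shift_zpow_apply]

theorem neg_one_zpow_eq (n : ℤ) : (-1 : ℝ) ^ n = 1 ∨ (-1 : ℝ) ^ n = -1 :=
  (Int.even_or_odd n).imp Even.neg_one_zpow Odd.neg_one_zpow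

instance : ContinuousConstSMul KleinGroup (ℝ × ℝ) where
  continuous_const_smul g := by
    obtain ⟨m, n, rfl⟩ := exists_eq_zpow_mul_zpow g
    simp only [zpow_mul_zpow_smul]
    fun_prop

instance : IsCancelSMul KleinGroup (ℝ × ℝ) := by
  refine isCancelSMul_iff_eq_one_of_smul_eq.mpr fun g p h ↦ ?_
  obtain ⟨m, n, rfl⟩ := exists_eq_zpow_mul_zpow g
  rw [zpow_mul_zpow_smul, Prod.ext_iff] at h
  obtain rfl : n = 0 := by simpa using h.2
  obtain rfl : m = 0 := by simpa using h.1
  simp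

instance : ProperlyDiscontinuousSMul KleinGroup (ℝ × ℝ) where
  finite_disjoint_inter_image {K L} hK hL := by
    obtain ⟨R, hR⟩ := (hK.union hL).isBounded.exists_norm_le
    -- A point and its translate both have sup norm at most `R`, so both exponents are at most `2 *
    -- R` in absolute value.
    obtain ⟨N, hN⟩ := exists_nat_ge (2 * R)
    refine ((Set.finite_Icc (-N : ℤ) N).prod (Set.finite_Icc (-N : ℤ) N)).image
      (fun k ↦ genB ^ k.1 * genA ^ k.2) |>.subset ?_
    rintro g ⟨_, ⟨p, hp, rfl⟩, hq⟩
    obtain ⟨m, n, rfl⟩ := exists_eq_zpow_mul_zpow g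
    have h₁ := hR p (.inl hp)
    have h₂ := hR _ (.inr hq)
    simp only [zpow_mul_zpow_smul, Prod.norm_def, sup_le_iff, Real.norm_eq_abs, abs_le] at h₁ h₂
    refine ⟨(m, n), ?_, rfl⟩
    simp only [Set.mem_prod, Set.mem_Icc, ← Int.cast_le (R := ℝ), Int.cast_neg, Int.cast_natCast]
    rcases neg_one_zpow_eq n with h | h <;> rw [h] at h₂ <;>
      refine ⟨⟨?_, ?_⟩, ?_, ?_⟩ <;> linarith [h₁.1.1, h₁.1.2, h₁.2.1, h₁.2.2, h₂.1.1, h₂.1.2,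
        h₂.2.1, h₂.2.2]

/-- The orbit space of the action on the plane. -/
abbrev OrbitSpace : Type := Quotient (MulAction.orbitRel KleinGroup (ℝ × ℝ))

theorem mk_eq_mk_iff {p q : ℝ × ℝ} :
    (Quotient.mk _ p : OrbitSpace) = Quotient.mk _ q ↔
      ∃ m n : ℤ, p.1 = (-1) ^ n * q.1 + m ∧ p.2 = q.2 + n := by
  rw [Quotient.eq]
  constructor
  · rintro ⟨g, rfl⟩
    obtain ⟨m, n, rfl⟩ := exists_eq_zpow_mul_zpow g
    exact ⟨m, n, by simp [zpow_mul_zpow_smul]⟩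
  · rintro ⟨m, n, h⟩
    exact ⟨genB ^ m * genA ^ n, by simpa [zpow_mul_zpow_smul, Prod.ext_iff, eq_comm] using h⟩

end KleinGroup

namespace KleinBottle

open KleinGroup

/-! ### The Klein bottle as orbit space -/

/-- The map from the Klein bottle to the orbit space induced by the inclusion of the square. -/
def toOrbitSpace : KleinBottle → OrbitSpace :=
  Quot.lift (fun p : I × I ↦ Quotient.mk _ ((p.1 : ℝ), (p.2 : ℝ))) (by
    rintro _ _ (t | s)
    · exact mk_eq_mk_iff.mpr ⟨-1, 0, by simp⟩
    · exact mk_eq_mk_iff.mpr ⟨1, -1, by simp⟩)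

theorem continuous_toOrbitSpace : Continuous toOrbitSpace :=
  continuous_quot_lift _ (continuous_quotient_mk'.comp (by fun_prop))

theorem proj_zero_left (t : I) : proj (0, t) = proj (1, t) := Quot.sound (.sides t)

theorem proj_zero_right (s : I) : proj (s, 0) = proj (unitInterval.symm s, 1) :=
  Quot.sound (.flip s)

/-- As `m = s + s'` lies in `[0, 2]`, either `m = 1`, which is the flip gluing, or both points are
corners, joined by a flip followed by a side gluing. -/
theorem proj_eq_of_bottom_top {s s' : I} {m : ℤ} (h : (s' : ℝ) = -s + m) :
    proj (s, 0) = proj (s', 1) := by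
  have hm : m = 0 ∨ m = 1 ∨ m = 2 := by
    have h₁ : (-1 : ℝ) < m := by linarith [s.2.1, s'.2.1]
    have h₂ : (m : ℝ) < 3 := by linarith [s.2.2, s'.2.2]
    norm_cast at h₁ h₂
    lia
  obtain rfl | rfl | rfl := hm
  · obtain rfl : s = 0 := Subtype.ext (by
      push_cast at h; rw [Set.Icc.coe_zero]; linarith [s.2.1, s'.2.1])
    obtain rfl : s' = 0 := Subtype.ext (by simpa using h)
    rw [proj_zero_right, unitInterval.symm_zero, proj_zero_left]
  · obtain rfl : s' = unitInterval.symm s := Subtype.ext (by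
      rw [unitInterval.coe_symm_eq, h]; push_cast; ring)
    exact proj_zero_right s
  · obtain rfl : s = 1 := Subtype.ext (by
      push_cast at h; rw [Set.Icc.coe_one]; linarith [s.2.2, s'.2.2])
    obtain rfl : s' = 1 := Subtype.ext (by rw [h]; norm_num)
    rw [proj_zero_right, unitInterval.symm_one, proj_zero_left]

theorem proj_eq_of_translate {s s' t : I} {m : ℤ} (h : (s' : ℝ) = s + m) :
    proj (s, t) = proj (s', t) := by
  have hm : m = -1 ∨ m = 0 ∨ m = 1 := by
    have h₁ : (-2 : ℝ) < m := by linarith [s.2.2, s'.2.1]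
    have h₂ : (m : ℝ) < 2 := by linarith [s.2.1, s'.2.2]
    norm_cast at h₁ h₂
    lia
  obtain rfl | rfl | rfl := hm
  · obtain rfl : s = 1 := Subtype.ext (by
      push_cast at h; rw [Set.Icc.coe_one]; linarith [s.2.2, s'.2.1])
    obtain rfl : s' = 0 := Subtype.ext (by rw [h]; norm_num)
    exact (proj_zero_left t).symm
  · obtain rfl : s' = s := Subtype.ext (by simpa using h)
    rfl
  · obtain rfl : s = 0 := Subtype.ext (by
      push_cast at h; rw [Set.Icc.coe_zero]; linarith [s.2.1, s'.2.2])
    obtain rfl : s' = 1 := Subtype.ext (by rw [h]; norm_num)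
    exact proj_zero_left t

theorem toOrbitSpace_injective : Function.Injective toOrbitSpace := by
  rintro ⟨s', t'⟩ ⟨s, t⟩ h
  change proj _ = proj _
  obtain ⟨m, n, h₁, h₂⟩ := mk_eq_mk_iff.mp h
  dsimp only at h₁ h₂
  have hn : n = -1 ∨ n = 0 ∨ n = 1 := by
    have h₁ : (-2 : ℝ) < n := by linarith [t.2.2, t'.2.1]
    have h₂ : (n : ℝ) < 2 := by linarith [t.2.1, t'.2.2]
    norm_cast at h₁ h₂
    lia
  obtain rfl | rfl | rfl := hn
  · obtain rfl : t = 1 := Subtype.ext (by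
      push_cast at h₂; rw [Set.Icc.coe_one]; linarith [t.2.2, t'.2.1])
    obtain rfl : t' = 0 := Subtype.ext (by rw [h₂]; norm_num)
    exact proj_eq_of_bottom_top (m := m) (by rw [h₁]; norm_num)
  · obtain rfl : t' = t := Subtype.ext (by simpa using h₂)
    exact (proj_eq_of_translate (m := m) (by rw [h₁]; norm_num)).symm
  · obtain rfl : t = 0 := Subtype.ext (by
      push_cast at h₂; rw [Set.Icc.coe_zero]; linarith [t.2.1, t'.2.2])
    obtain rfl : t' = 1 := Subtype.ext (by rw [h₂]; norm_num)
    exact (proj_eq_of_bottom_top (m := m) (by rw [h₁]; norm_num)).symm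

theorem toOrbitSpace_surjective : Function.Surjective toOrbitSpace := by
  rintro ⟨x, y⟩
  -- Lowering `y` by `⌊y⌋` reflects `x` once per unit; a horizontal translation then brings the
  -- result into the square.
  refine ⟨proj (⟨Int.fract ((-1) ^ ⌊y⌋ * x), Int.fract_nonneg _, (Int.fract_lt_one _).le⟩,
    ⟨Int.fract y, Int.fract_nonneg _, (Int.fract_lt_one _).le⟩), ?_⟩
  refine mk_eq_mk_iff.mpr ⟨-⌊(-1) ^ ⌊y⌋ * x⌋, -⌊y⌋, ?_, ?_⟩
  · rw [zpow_neg]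
    rcases neg_one_zpow_eq ⌊y⌋ with h | h <;> simp [h, Int.fract, sub_eq_add_neg]
  · simp [Int.fract, sub_eq_add_neg]

instance : CompactSpace KleinBottle := inferInstanceAs (CompactSpace (Quot KleinGlue))

/-- The Klein bottle is the orbit space of the plane. -/
noncomputable def homeomorphOrbitSpace : KleinBottle ≃ₜ OrbitSpace :=
  Continuous.homeoOfEquivCompactToT2
    (f := Equiv.ofBijective toOrbitSpace ⟨toOrbitSpace_injective, toOrbitSpace_surjective⟩)
    continuous_toOrbitSpace

/-! ### The universal covering and the fundamental group -/

/-- The universal covering of the Klein bottle by the plane. -/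
noncomputable def cover : ℝ × ℝ → KleinBottle :=
  homeomorphOrbitSpace.symm ∘ Quotient.mk (MulAction.orbitRel KleinGroup (ℝ × ℝ))

theorem isQuotientCoveringMap_cover : IsQuotientCoveringMap cover KleinGroup :=
  isQuotientCoveringMap_quotientMk_of_properlyDiscontinuousSMul.homeomorph_comp _

theorem cover_coe (p : I × I) : cover ((p.1 : ℝ), (p.2 : ℝ)) = proj p :=
  homeomorphOrbitSpace.symm_apply_eq.mpr rfl

instance : PathConnectedSpace KleinBottle :=
  isQuotientCoveringMap_cover.surjective.pathConnectedSpace isQuotientCoveringMap_cover.continuous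

/-- The origin as a point over the base point. -/
noncomputable def origin : cover ⁻¹' {basePoint} := ⟨(0, 0), cover_coe (0, 0)⟩

/-- The fundamental group of the Klein bottle is opposite to the deck group. -/
noncomputable def deckEquiv : FundamentalGroup KleinBottle basePoint ≃* KleinGroupᵐᵒᵖ :=
  isQuotientCoveringMap_cover.fundamentalGroupEquiv origin

/-- The deck element of a loop is read off from the endpoint of its lift at the origin. -/
theorem deckEquiv_loopClass {γ : Path basePoint basePoint} {g : KleinGroup}
    (Γ : Path ((0, 0) : ℝ × ℝ) (g • (0, 0))) (h : ∀ t, cover (Γ t) = γ t) :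
    deckEquiv (loopClass γ) = MulOpposite.op g := by
  refine (isQuotientCoveringMap_cover.fundamentalGroupToMulOpposite_apply_eq_Iff).mpr ?_
  have hg : g • ((0, 0) : ℝ × ℝ) ∈ cover ⁻¹' {basePoint} := by
    rw [← Γ.target, Set.mem_preimage, h, γ.target]; rfl
  have := isQuotientCoveringMap_cover.isCoveringMap.monodromy_eq_of_map_eq
    (γ := .mk γ) (ex := origin) (ey := ⟨_, hg⟩) (.mk Γ)
    (congrArg Path.Homotopic.Quotient.mk (Path.ext (funext h)))
  exact (congrArg Subtype.val this).symm

theorem deckEquiv_loopAlpha : deckEquiv (loopClass loopAlpha) = MulOpposite.op genA := by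
  have hg : genA • ((0, 0) : ℝ × ℝ) = (0, 1) := by
    simpa using zpow_mul_zpow_smul 0 1 (0, 0)
  refine deckEquiv_loopClass (Path.cast ⟨⟨fun t : I ↦ (0, (t : ℝ)), by fun_prop⟩, rfl, rfl⟩
    (by simp) (by simp [hg])) fun t ↦ by simpa using! cover_coe (0, t)

theorem deckEquiv_loopBeta : deckEquiv (loopClass loopBeta) = MulOpposite.op genB := by
  have hg : genB • ((0, 0) : ℝ × ℝ) = (1, 0) := by
    simpa using zpow_mul_zpow_smul 1 0 (0, 0)
  refine deckEquiv_loopClass (Path.cast ⟨⟨fun t : I ↦ ((t : ℝ), 0), by fun_prop⟩, rfl, rfl⟩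
    (by simp) (by simp [hg])) fun t ↦ by simpa using! cover_coe (t, 0)

/-- The isomorphism from the presented group to the fundamental group. -/
noncomputable def presentation : KleinGroup ≃* FundamentalGroup KleinBottle basePoint :=
  reverseEquiv.trans deckEquiv.symm

theorem presentation_alpha :
    presentation (PresentedGroup.of KleinGen.α) = loopClass loopAlpha :=
  deckEquiv.symm_apply_eq.mpr ((reverse_of _).trans deckEquiv_loopAlpha.symm)

theorem presentation_beta :
    presentation (PresentedGroup.of KleinGen.β) = loopClass loopBeta :=
  deckEquiv.symm_apply_eq.mpr ((reverse_of _).trans deckEquiv_loopBeta.symm)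

theorem boundary_homotopic_refl :
    (((loopBeta.trans loopAlpha).trans loopBeta).trans loopAlpha.symm).Homotopic
      (Path.refl basePoint) := by
  -- Multiplication of classes concatenates from right to left, so the boundary word appears
  -- reversed.
  have h : (loopClass loopAlpha)⁻¹ *
      (loopClass loopBeta * (loopClass loopAlpha * loopClass loopBeta)) = 1 := by
    rw [← presentation_alpha, ← presentation_beta, ← map_mul, ← map_mul, ← map_inv, ← map_mul,
      map_eq_one_iff _ presentation.injective, inv_mul_eq_one, ← mul_assoc]
    exact (mul_inv_eq_one.mp relation).symm
  exact Path.Homotopic.Quotient.eq.mp h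

end KleinBottle

/-- The first part is the relation as a homotopy of loops, where `trans` concatenates from left to
right. In the second part, the product of Mathlib's `FundamentalGroup` concatenates from right to
left; the reversed word `α⁻¹ β α β` is a cyclic permutation of `β α β α⁻¹`, so both conventions
give the same relation. -/
theorem mainTheorem1 :
    (((KleinBottle.loopBeta.trans KleinBottle.loopAlpha).trans KleinBottle.loopBeta).trans
        KleinBottle.loopAlpha.symm).Homotopic (Path.refl KleinBottle.basePoint) ∧
    (∃ e : KleinGroup ≃* FundamentalGroup KleinBottle KleinBottle.basePoint,
      e (PresentedGroup.of KleinGen.α) = KleinBottle.loopClass KleinBottle.loopAlpha ∧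
      e (PresentedGroup.of KleinGen.β) = KleinBottle.loopClass KleinBottle.loopBeta) ∧
    (∀ x : KleinBottle, Nonempty (KleinGroup ≃* FundamentalGroup KleinBottle x)) := by
  refine ⟨KleinBottle.boundary_homotopic_refl, ⟨KleinBottle.presentation,
    KleinBottle.presentation_alpha, KleinBottle.presentation_beta⟩, fun x ↦ ⟨?_⟩⟩
  exact KleinBottle.presentation.trans
    (FundamentalGroup.fundamentalGroupMulEquivOfPathConnected KleinBottle.basePoint x)
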